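/- Let $n \ge 1$, let $S_n$ be the symmetric group on $n$ letters and let $A_n$ be its alternating subgroup. For a nonempty subset $C \subseteq S_n$, let $$\delta(C) = \frac{|\{\sigma \in C : \sigma \text{ has no fixed points}\}|}{|C|},$$ so that $\delta(S_n) = D_n/n!$, where $D_n$ is the number of fixed-point-free elements (derangements) of $S_n$. Let $G$ be a subgroup of $S_n$. (1) If $C$ is a (left or right) coset of $G$ in $S_n$ and $\delta(C) = \delta(S_n)$, then $G = C = S_n$. (2) If $n \ge 5$, and $C$ is any subset of $S_n$ with $|C| = |G|$ and $\delta(C) = \delta(S_n)$, then $G = A_n$ or $G = S_n$. (3) If $n \ge 5$, and $|G|$ is divisible by the denominator of $D_n/n!$ in lowest terms, then $G = A_n$ or $G = S_n$. -/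

import Mathlib

open Equiv
open scoped Pointwise

/-- The proportion of derangements (permutations without fixed points) in a set `C` of
permutations of `α`. -/
noncomputable def derangementProportion {α : Type*} (C : Set (Perm α)) : ℚ :=
  ({σ : Perm α | σ ∈ C ∧ ∀ x : α, σ x ≠ x}.ncard : ℚ) / (C.ncard : ℚ)

/-- `C` is a coset (left or right) of the subgroup `G`: `C = g G` or `C = G g` for some `g`. -/
def IsCosetOf {Γ : Type*} [Group Γ] (C : Set Γ) (G : Subgroup Γ) : Prop :=
  (∃ g : Γ, C = g • (G : Set Γ)) ∨ (∃ g : Γ, C = MulOpposite.op g • (G : Set Γ))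

/-! Each hypothesis on `G` forces `G.index` to divide `D_n`. Since `D_{k+m} ≡ (-1)^m D_k` mod `m`, a
prime `p ∣ n - k` divides `D_n` only if it divides `D_k`. As `D_0 = D_2 = 1` and `D_3 = 2`, the
index is prime to every prime factor of `n` or `n - 2` and to every odd one of `n - 3`; for such
`p`, `G` contains a conjugate of every `p`-subgroup of `S_n`.

For `n ≥ 5`, subgroups of commuting column translations make `G` transitive, then primitive
(`isPreprimitive_of_index_dvd_numDerangements`). Usually some prime `p ≤ n/2` does not divide `D_n`;
then `G` contains a `p`-cycle, Jordan's theorem makes `G` highly transitive, and a commutator is a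
3-cycle, so `A_n ≤ G`. Degrees 5 and 7 are handled directly.

For cosets, `A_n` is excluded because even and odd derangements are not equinumerous; in degree 4,
index 3 is excluded by a finite check. -/

/-! ### Arithmetic of derangement numbers -/

theorem dvd_numDerangements_add_sub (m k : ℕ) :
    (m : ℤ) ∣ (numDerangements (k + m) : ℤ) - (-1) ^ m * numDerangements k := by
  induction k with
  | zero =>
    rcases m with _ | m
    · simp
    · rw [Nat.zero_add, numDerangements_succ, numDerangements_zero, pow_succ]
      exact ⟨numDerangements m, by push_cast; ring⟩
  | succ k ih =>
    obtain ⟨c, hc⟩ := ih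
    rw [Nat.add_right_comm, numDerangements_succ, numDerangements_succ]
    refine ⟨(k + 1 : ℤ) * c + numDerangements (k + m), ?_⟩
    push_cast
    linear_combination (k + 1 : ℤ) * hc

theorem dvd_numDerangements_iff_of_dvd_sub {p n k : ℕ} (hk : k ≤ n) (h : p ∣ n - k) :
    p ∣ numDerangements n ↔ p ∣ numDerangements k := by
  have h1 := (Int.natCast_dvd_natCast.mpr h).trans (dvd_numDerangements_add_sub (n - k) k)
  rw [Nat.add_sub_cancel' hk] at h1
  rw [← Int.natCast_dvd_natCast, ← Int.natCast_dvd_natCast, dvd_iff_dvd_of_dvd_sub h1]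
  rcases neg_one_pow_eq_or ℤ (n - k) with h | h <;> simp [h]

theorem ncard_derangements (n : ℕ) :
    {σ : Perm (Fin n) | ∀ x, σ x ≠ x}.ncard = numDerangements n := by
  rw [← card_derangements_fin_eq_numDerangements, ← Nat.card_eq_fintype_card]
  rfl

theorem derangementProportion_univ (n : ℕ) :
    derangementProportion (Set.univ : Set (Perm (Fin n))) =
      (numDerangements n : ℚ) / (n.factorial : ℚ) := by
  simp only [derangementProportion, Set.mem_univ, true_and, ncard_derangements, Set.ncard_univ,
    Nat.card_perm, Nat.card_fin]

theorem index_dvd_numDerangements {n : ℕ} {G : Subgroup (Perm (Fin n))}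
    (h : (derangementProportion (Set.univ : Set (Perm (Fin n)))).den ∣ Nat.card G) :
    G.index ∣ numDerangements n := by
  obtain ⟨t, ht⟩ := h
  have hn := G.card_mul_index
  rw [Nat.card_perm, Nat.card_fin, ht] at hn
  set x := derangementProportion (Set.univ : Set (Perm (Fin n))) with hx
  have hf : (n.factorial : ℚ) ≠ 0 := by exact_mod_cast n.factorial_ne_zero
  have hD : (numDerangements n : ℚ) = x * n.factorial := by
    rw [hx, derangementProportion_univ, div_mul_cancel₀ _ hf]
  have h2 : (numDerangements n : ℚ) = x.num * (t * G.index) := by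
    rw [hD, ← hn]
    push_cast
    rw [← mul_assoc, ← mul_assoc, Rat.mul_den_eq_num, mul_assoc]
  have h3 : (numDerangements n : ℤ) = x.num * (t * G.index) := by exact_mod_cast h2
  rw [← Int.natCast_dvd_natCast, h3]
  exact ⟨x.num * t, by ring⟩

theorem den_div_natCast_dvd (a b : ℕ) : ((a : ℚ) / b).den ∣ b := by
  have h := Rat.den_dvd a b
  rw [Rat.divInt_eq_div] at h
  exact Int.natCast_dvd_natCast.mp h

/-- A subset with the same proportion of derangements as the full symmetric group has
cardinality divisible by the denominator of that proportion. -/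
theorem den_dvd_ncard {n : ℕ} {C : Set (Perm (Fin n))}
    (h : derangementProportion C = derangementProportion (Set.univ : Set (Perm (Fin n)))) :
    (derangementProportion (Set.univ : Set (Perm (Fin n)))).den ∣ C.ncard := by
  rw [← h]
  exact den_div_natCast_dvd _ _

theorem exists_prime_two_mul_le_not_dvd_numDerangements {n : ℕ} (hn : 5 ≤ n) (h5 : n ≠ 5)
    (h7 : n ≠ 7) : ∃ p, p.Prime ∧ 2 * p ≤ n ∧ ¬ p ∣ numDerangements n := by
  have key : ∀ p k : ℕ, p.Prime → k ≤ n → p ∣ n - k → ¬ p ∣ numDerangements k →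
      ¬ p ∣ numDerangements n := fun p k _ hk h h' ↦
    mt (dvd_numDerangements_iff_of_dvd_sub hk h).mp h'
  have half : ∀ m : ℕ, 2 ≤ m → m ≤ n → ¬ m.Prime → 2 * m.minFac ≤ n := by
    intro m hm hmn hp
    have h1 := Nat.minFac_prime (n := m) (by omega)
    obtain ⟨c, hc⟩ := m.minFac_dvd
    have : c ≠ 0 := by rintro rfl; omega
    have : c ≠ 1 := by
      rintro rfl
      rw [mul_one] at hc
      exact hp (hc ▸ h1)
    have : 2 ≤ c := by omega
    nlinarith [h1.two_le]
  by_cases hnp : n.Prime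
  swap
  · have h1 := Nat.minFac_prime (n := n) (by omega)
    exact ⟨_, h1, half n (by omega) le_rfl hnp,
      key _ 0 h1 (by omega) n.minFac_dvd (by simpa using h1.ne_one)⟩
  by_cases hnp2 : (n - 2).Prime
  swap
  · have h1 := Nat.minFac_prime (n := n - 2) (by omega)
    exact ⟨_, h1, half (n - 2) (by omega) (by omega) hnp2,
      key _ 2 h1 (by omega) (n - 2).minFac_dvd
        (by simpa [numDerangements_add_two] using h1.ne_one)⟩
  have hodd : n % 2 = 1 := (hnp.eq_two_or_odd).resolve_left (by omega)
  -- Now `n` and `n - 2` are both prime. An odd prime factor of the even number `n - 3` is at most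
  -- half of it.
  by_cases hq : ∃ q, q.Prime ∧ q ∣ n - 3 ∧ q ≠ 2
  · obtain ⟨q, hq, hqn, hq2⟩ := hq
    refine ⟨q, hq, ?_, key q 3 hq (by omega) hqn ?_⟩
    · have h : q ∣ 2 * ((n - 3) / 2) := by
        rwa [Nat.mul_div_cancel' (by omega)]
      have h' := ((Nat.coprime_primes hq Nat.prime_two).mpr hq2).dvd_of_dvd_mul_left h
      have := Nat.le_of_dvd (by omega) h'
      omega
    · exact fun h ↦ hq2 ((Nat.prime_dvd_prime_iff_eq hq Nat.prime_two).mp h)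
  push Not at hq
  have hpow := Nat.eq_prime_pow_of_unique_prime_dvd (n := n - 3) (p := 2) (by omega)
    fun {q} h h' ↦ hq q h h'
  -- Now `n - 2 = 2 ^ k + 1` is prime. Odd `k` gives `3 ∣ n - 2`, so `n = 5`; `k ≡ 2` mod 4 gives `5
  -- ∣ n - 2`, so `n = 7`. If `4 ∣ k`, then `n ≡ 4` mod 5, and `D_4 = 9` is prime to 5.
  set k := (n - 3).primeFactorsList.length
  obtain ⟨j, hj⟩ : ∃ j, k = 4 * j + k % 4 := ⟨k / 4, by omega⟩
  have h16 : n - 3 = 16 ^ j * 2 ^ (k % 4) := by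
    rw [hpow, show 16 = 2 ^ 4 by norm_num, ← pow_mul, ← pow_add, ← hj]
  have h15 : (16 : ℕ) ^ j % 15 = 1 := by rw [Nat.pow_mod]; simp
  have hnot : ∀ q, 1 < q → q ∣ n - 2 → q = n - 2 := fun q h1 h2 ↦
    ((Nat.dvd_prime hnp2).mp h2).resolve_left (by omega)
  have h4 : k % 4 = 0 ∨ k % 4 = 1 ∨ k % 4 = 2 ∨ k % 4 = 3 := by omega
  rcases h4 with h4 | h4 | h4 | h4 <;> rw [h4] at h16
  · refine ⟨5, by norm_num, ?_, key 5 4 (by norm_num) (by omega) (by omega) (by decide)⟩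
    omega
  · have := hnot 3 (by norm_num) (by omega)
    omega
  · have := hnot 5 (by norm_num) (by omega)
    omega
  · have := hnot 3 (by norm_num) (by omega)
    omega

/-! ### Column translations inside `G` -/

/-- Translation of the columns of `(Fin u × ZMod q) ⊕ Fin r` by the entries of a vector. -/
def columnShift (u q r : ℕ) :
    Multiplicative (Fin u → ZMod q) →* Perm ((Fin u × ZMod q) ⊕ Fin r) where
  toFun f := Equiv.sumCongr
    (Equiv.prodShear (Equiv.refl (Fin u)) fun i ↦ Equiv.addLeft (f.toAdd i)) (Equiv.refl (Fin r))
  map_one' := by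
    ext x
    rcases x with ⟨i, a⟩ | y <;> simp
  map_mul' f g := by
    ext x
    rcases x with ⟨i, a⟩ | y <;> simp

@[simp]
theorem columnShift_inl {u q r : ℕ} (f : Multiplicative (Fin u → ZMod q)) (i : Fin u)
    (a : ZMod q) : columnShift u q r f (Sum.inl (i, a)) = Sum.inl (i, f.toAdd i + a) := rfl

@[simp]
theorem columnShift_inr {u q r : ℕ} (f : Multiplicative (Fin u → ZMod q)) (y : Fin r) :
    columnShift u q r f (Sum.inr y) = Sum.inr y := rfl

/-- A subgroup whose index is prime to `p` contains a conjugate of every `p`-subgroup. -/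
theorem exists_conj_smul_le_of_not_dvd_index {Γ : Type*} [Group Γ] [Finite Γ] {p : ℕ}
    [Fact p.Prime] {G P : Subgroup Γ} (hG : ¬ p ∣ G.index) (hP : IsPGroup p P) :
    ∃ g : Γ, MulAut.conj g • P ≤ G := by
  obtain ⟨Q, hQ⟩ := hP.exists_le_sylow
  obtain ⟨R⟩ : Nonempty (Sylow p G) := inferInstance
  have hR : IsPGroup p ((R : Subgroup G).map G.subtype) := R.isPGroup'.map _
  have hi : ¬ p ∣ ((R : Subgroup G).map G.subtype).index := by
    rw [Subgroup.index_map_subtype]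
    exact fun h ↦ (Fact.out : p.Prime).dvd_mul.mp h |>.elim R.not_dvd_index hG
  obtain ⟨g, hg⟩ := MulAction.exists_smul_eq Γ Q (hR.toSylow hi)
  refine ⟨g, le_trans (Subgroup.pointwise_smul_le_pointwise_smul_iff.mpr hQ) ?_⟩
  rw [← Sylow.coe_subgroup_smul, hg]
  exact Subgroup.map_subtype_le _

/-- A subgroup of index prime to `p` contains all column translations of a suitable arrangement
of `u` columns whose length `q` is a power of `p`. -/
theorem exists_equiv_columnShift_mem {α : Type*} [Fintype α] {p : ℕ} (hp : p.Prime)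
    {G : Subgroup (Perm α)} (hG : ¬ p ∣ G.index) {q u j r : ℕ} (hq : q = p ^ j)
    (hα : Nat.card α = q * u + r) :
    ∃ e : α ≃ (Fin u × ZMod q) ⊕ Fin r, ∀ f, e.symm.permCongr (columnShift u q r f) ∈ G := by
  classical
  have : Fact p.Prime := ⟨hp⟩
  have : NeZero q := ⟨hq ▸ pow_ne_zero _ hp.ne_zero⟩
  obtain ⟨e⟩ : Nonempty (α ≃ (Fin u × ZMod q) ⊕ Fin r) := by
    rw [← Finite.card_eq, hα, Nat.card_sum, Nat.card_prod, Nat.card_zmod, Nat.card_fin,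
      Nat.card_fin, mul_comm]
  let φ : Multiplicative (Fin u → ZMod q) →* Perm α :=
    (e.symm.permCongrHom : _ →* Perm α).comp (columnShift u q r)
  have hφ : IsPGroup p φ.range := by
    rw [MonoidHom.range_eq_map]
    refine IsPGroup.map (fun x ↦ ⟨j, ?_⟩) φ
    rw [← hq]
    ext i
    simp
  obtain ⟨g, hg⟩ := exists_conj_smul_le_of_not_dvd_index hG hφ
  refine ⟨g.symm.trans e, fun f ↦ ?_⟩
  convert hg (Subgroup.smul_mem_pointwise_smul _ (MulAut.conj g) _ ⟨f, rfl⟩) using 1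
  rfl

section Columns

variable {α : Type*} {G : Subgroup (Perm α)} {u q r : ℕ}
  {e : α ≃ (Fin u × ZMod q) ⊕ Fin r} {B : Set α}

/-- The translation of a single column, as an element of the group. -/
theorem exists_mem_translate_column (he : ∀ f, e.symm.permCongr (columnShift u q r f) ∈ G)
    (i : Fin u) (b : ZMod q) :
    ∃ σ ∈ G, (∀ a, σ (e.symm (Sum.inl (i, a))) = e.symm (Sum.inl (i, b + a))) ∧
      (∀ k ≠ i, ∀ a, σ (e.symm (Sum.inl (k, a))) = e.symm (Sum.inl (k, a))) ∧
      ∀ y, σ (e.symm (Sum.inr y)) = e.symm (Sum.inr y) := by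
  refine ⟨_, he (Multiplicative.ofAdd (Pi.single i b)), ?_, ?_, ?_⟩
  · simp [Equiv.permCongr_apply]
  · intro k hk a
    simp [Equiv.permCongr_apply, hk]
  · simp [Equiv.permCongr_apply]

theorem MulAction.IsBlock.apply_mem (hB : MulAction.IsBlock G B) {σ : Perm α} (hσ : σ ∈ G) {x : α}
    (hx : x ∈ B) (hσx : σ x ∈ B) {y : α} (hy : y ∈ B) : σ y ∈ B := by
  have := MulAction.isBlock_iff_smul_eq_of_mem.mp hB (g := ⟨σ, hσ⟩) hx hσx
  rw [← this]
  exact Set.smul_mem_smul_set hy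

theorem MulAction.IsBlock.symm_apply_mem (hB : MulAction.IsBlock G B) {σ : Perm α} (hσ : σ ∈ G) {x : α}
    (hx : x ∈ B) (hσx : σ x ∈ B) {y : α} (hy : y ∈ B) : σ.symm y ∈ B :=
  hB.apply_mem (G.inv_mem hσ) hσx (by simpa using hx) hy

/-- A block inside one column is a coset of a subgroup of `ZMod q`. Otherwise it has a point off the
column, fixed by the translations of that column; these therefore preserve the block. -/
theorem column_subset_or_ncard_dvd [NeZero q]
    (he : ∀ f, e.symm.permCongr (columnShift u q r f) ∈ G)
    (hB : MulAction.IsBlock G B) {i : Fin u} {a : ZMod q} (ha : e.symm (Sum.inl (i, a)) ∈ B) :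
    (∀ b, e.symm (Sum.inl (i, b)) ∈ B) ∨ B.ncard ∣ q := by
  by_cases h : ∀ z ∈ B, ∃ b, z = e.symm (Sum.inl (i, b))
  · right
    let S : AddSubgroup (ZMod q) :=
      { carrier := {b | e.symm (Sum.inl (i, b + a)) ∈ B}
        zero_mem' := by simpa using ha
        add_mem' := by
          intro x y hx hy
          obtain ⟨σ, hσ, h1, -, -⟩ := exists_mem_translate_column he i x
          have := hB.apply_mem hσ ha (by rw [h1]; exact hx) hy
          rw [h1] at this
          simpa [add_assoc] using this
        neg_mem' := by
          intro x hx
          obtain ⟨σ, hσ, h1, -, -⟩ := exists_mem_translate_column he i x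
          have := hB.symm_apply_mem hσ ha (by rw [h1]; exact hx) ha
          rwa [show σ.symm (e.symm (Sum.inl (i, a))) = e.symm (Sum.inl (i, -x + a)) by
            rw [Equiv.symm_apply_eq, h1]; simp] at this }
    have hS : B = (fun b ↦ e.symm (Sum.inl (i, b + a))) '' (S : Set (ZMod q)) := by
      ext z
      constructor
      · intro hz
        obtain ⟨b, rfl⟩ := h z hz
        refine ⟨b - a, ?_, by simp⟩
        change e.symm (Sum.inl (i, b - a + a)) ∈ B
        simpa using hz
      · rintro ⟨b, hb, rfl⟩
        exact hb
    have hinj : Function.Injective fun b ↦ e.symm (Sum.inl (i, b + a)) := by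
      intro x y hxy
      simpa using hxy
    rw [hS, Set.ncard_image_of_injective _ hinj]
    have := S.card_addSubgroup_dvd_card
    rwa [Nat.card_zmod] at this
  · left
    push Not at h
    obtain ⟨z, hz, hzi⟩ := h
    intro b
    obtain ⟨σ, hσ, h1, h2, h3⟩ := exists_mem_translate_column he i (b - a)
    have hfix : σ z = z := by
      obtain ⟨w, rfl⟩ := e.symm.surjective z
      rcases w with ⟨k, c⟩ | y
      · refine h2 k ?_ c
        rintro rfl
        exact hzi c rfl
      · exact h3 y
    have := hB.apply_mem hσ hz (by rwa [hfix]) ha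
    rw [h1] at this
    simpa using this

/-- A union of columns and of remaining points has cardinality congruent to the number of
remaining points. -/
theorem ncard_eq_of_column_subset [NeZero q]
    (hcol : ∀ i a, e.symm (Sum.inl (i, a)) ∈ B → ∀ b, e.symm (Sum.inl (i, b)) ∈ B) :
    ∃ t, B.ncard = q * t + {y | e.symm (Sum.inr y) ∈ B}.ncard := by
  let T : Set (Fin u) := {i | e.symm (Sum.inl (i, 0)) ∈ B}
  have h : B = (fun x ↦ e.symm (Sum.inl x)) '' (T ×ˢ (Set.univ : Set (ZMod q))) ∪
      (fun y ↦ e.symm (Sum.inr y)) '' {y | e.symm (Sum.inr y) ∈ B} := by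
    ext z
    obtain ⟨w, rfl⟩ := e.symm.surjective z
    rcases w with ⟨i, a⟩ | y
    · simpa [T] using ⟨fun h ↦ hcol i a h 0, fun h ↦ hcol i 0 h a⟩
    · simp
  have hα : Finite α := .of_equiv _ e.symm
  refine ⟨T.ncard, ?_⟩
  conv_lhs => rw [h]
  rw [Set.ncard_union_eq, Set.ncard_image_of_injective, Set.ncard_image_of_injective,
    Set.ncard_prod, Set.ncard_univ, Nat.card_zmod, mul_comm]
  · exact e.symm.injective.comp Sum.inr_injective
  · exact e.symm.injective.comp Sum.inl_injective
  · rw [Set.disjoint_left]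
    rintro _ ⟨x, -, rfl⟩ ⟨y, -, h⟩
    simp at h

end Columns

/-! ### Transitivity and primitivity -/

theorem not_dvd_index_of_dvd {n : ℕ} {G : Subgroup (Perm (Fin n))}
    (hG : G.index ∣ numDerangements n) {p : ℕ} (hp : p.Prime) (hpn : p ∣ n) : ¬ p ∣ G.index := by
  intro h
  have := (dvd_numDerangements_iff_of_dvd_sub (Nat.zero_le n) hpn).mp (h.trans hG)
  exact hp.one_lt.ne' (by simpa using this)

theorem isPretransitive_of_index_dvd_numDerangements {n : ℕ} {G : Subgroup (Perm (Fin n))}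
    (hG : G.index ∣ numDerangements n) : MulAction.IsPretransitive G (Fin n) := by
  rcases n.eq_zero_or_pos with rfl | hn
  · exact ⟨fun x ↦ x.elim0⟩
  suffices h : ∀ x : Fin n, MulAction.orbit G x = Set.univ by
    exact ⟨fun x y ↦ MulAction.mem_orbit_iff.mp (h x ▸ Set.mem_univ y)⟩
  intro x
  -- For each prime power `p ^ j ∣ n`, the orbit is a union of columns of length `p ^ j`, with no
  -- points left over.
  have hdvd : n ∣ (MulAction.orbit G x).ncard := by
    rw [Nat.dvd_iff_prime_pow_dvd_dvd]
    intro p j hp hj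
    rcases j.eq_zero_or_pos with rfl | hj0
    · simp
    have hpn : p ∣ n := (dvd_pow_self p hj0.ne').trans hj
    have hpi := not_dvd_index_of_dvd hG hp hpn
    obtain ⟨u, hu⟩ := hj
    obtain ⟨e, he⟩ := exists_equiv_columnShift_mem (α := Fin n) hp hpi (u := u) (r := 0) rfl
      (by simpa using hu)
    have : NeZero (p ^ j) := ⟨pow_ne_zero _ hp.ne_zero⟩
    obtain ⟨t, ht⟩ := ncard_eq_of_column_subset (e := e) (B := MulAction.orbit G x) (by
      intro i a ha b
      obtain ⟨σ, hσ, h1, -, -⟩ := exists_mem_translate_column he i (b - a)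
      have h2 : (⟨σ, hσ⟩ : G) • e.symm (Sum.inl (i, a)) ∈ MulAction.orbit G x :=
        MulAction.mem_orbit_of_mem_orbit _ ha
      rw [Subgroup.smul_def, Perm.smul_def, h1] at h2
      simpa using h2)
    rw [ht, Set.eq_empty_of_isEmpty {y | _}, Set.ncard_empty]
    simp
  rw [Set.eq_univ_iff_ncard, Nat.card_fin]
  refine le_antisymm ((Set.ncard_le_card _).trans (by simp)) (Nat.le_of_dvd ?_ hdvd)
  exact (Set.ncard_pos).mpr ⟨x, MulAction.mem_orbit_self x⟩

section Block

variable {n : ℕ} {G : Subgroup (Perm (Fin n))} {B : Set (Fin n)}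

theorem dvd_or_dvd_of_isBlock (hG : G.index ∣ numDerangements n) (hB : MulAction.IsBlock G B)
    {p j : ℕ} (hp : p.Prime) (hj : p ^ j ∣ n) : B.ncard ∣ p ^ j ∨ p ^ j ∣ B.ncard := by
  rcases j.eq_zero_or_pos with rfl | hj0
  · simp
  have hpn : p ∣ n := (dvd_pow_self p hj0.ne').trans hj
  have hpi := not_dvd_index_of_dvd hG hp hpn
  obtain ⟨u, hu⟩ := hj
  obtain ⟨e, he⟩ := exists_equiv_columnShift_mem (α := Fin n) hp hpi (u := u) (r := 0) rfl
    (by simpa using hu)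
  have : NeZero (p ^ j) := ⟨pow_ne_zero _ hp.ne_zero⟩
  refine or_iff_not_imp_left.mpr fun h ↦ ?_
  obtain ⟨t, ht⟩ := ncard_eq_of_column_subset fun i a ha ↦
    (column_subset_or_ncard_dvd he hB ha).resolve_right h
  rw [ht, Set.eq_empty_of_isEmpty {y | _}, Set.ncard_empty]
  simp

/-- Some prime power `p ^ j ∣ n` does not divide `B.ncard`, so `B.ncard` is a power of `p`;
comparing it with any other prime factor of `n` forces that prime to be `p`. -/
theorem exists_eq_prime_pow_of_isBlock (hG : G.index ∣ numDerangements n)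
    (hB : MulAction.IsBlock G B) (hB1 : 1 < B.ncard) (hBn : B.ncard < n) :
    ∃ p m, p.Prime ∧ n = p ^ m := by
  have h : ¬ n ∣ B.ncard := fun h ↦ absurd (Nat.le_of_dvd (by omega) h) (by omega)
  rw [Nat.dvd_iff_prime_pow_dvd_dvd] at h
  push Not at h
  obtain ⟨p, j, hp, hj, hjB⟩ := h
  obtain ⟨a, -, ha⟩ := (Nat.dvd_prime_pow hp).mp
    ((dvd_or_dvd_of_isBlock hG hB hp hj).resolve_right hjB)
  refine ⟨p, _, hp, Nat.eq_prime_pow_of_unique_prime_dvd (by omega) fun {d} hd hdn ↦ ?_⟩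
  have ha0 : a ≠ 0 := by rintro rfl; rw [pow_zero] at ha; omega
  rcases dvd_or_dvd_of_isBlock hG hB hd (j := 1) (by simpa using hdn) with h | h
  · rw [pow_one] at h
    exact ((Nat.prime_dvd_prime_iff_eq hp hd).mp
      (((dvd_pow_self p ha0).trans (ha ▸ dvd_rfl)).trans h)).symm
  · rw [pow_one, ha] at h
    exact (Nat.prime_dvd_prime_iff_eq hd hp).mp (hd.dvd_of_dvd_pow h)

/-- For a prime `q` dividing `n - r`, every nontrivial block is a union of columns of
length `q` and of some of the `r` remaining points. -/
theorem exists_equiv_column_subset (hG : G.index ∣ numDerangements n)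
    {q r : ℕ} (hq : q.Prime) (hr : r ≤ n) (hqn : q ∣ n - r) (hqr : ¬ q ∣ numDerangements r)
    (hqn' : ¬ q ∣ n) :
    ∃ e : Fin n ≃ (Fin ((n - r) / q) × ZMod q) ⊕ Fin r,
      ∀ B : Set (Fin n), MulAction.IsBlock G B → 1 < B.ncard → B.ncard ∣ n →
        ∃ t, B.ncard = q * t + {y | e.symm (Sum.inr y) ∈ B}.ncard := by
  have hqi : ¬ q ∣ G.index := fun h ↦
    hqr ((dvd_numDerangements_iff_of_dvd_sub hr hqn).mp (h.trans hG))
  obtain ⟨e, he⟩ := exists_equiv_columnShift_mem (α := Fin n) hq hqi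
    (u := (n - r) / q) (r := r) (pow_one q).symm (by rw [Nat.mul_div_cancel' hqn, Nat.card_fin]; omega)
  have : NeZero q := ⟨hq.ne_zero⟩
  refine ⟨e, fun B hB hB1 hBn ↦ ncard_eq_of_column_subset fun i a ha ↦
    (column_subset_or_ncard_dvd he hB ha).resolve_right fun h ↦ hqn' ?_⟩
  rcases (Nat.dvd_prime hq).mp h with h | h
  · omega
  · rwa [h] at hBn

theorem isPreprimitive_of_index_dvd_numDerangements (hn : 5 ≤ n)
    (hG : G.index ∣ numDerangements n) : MulAction.IsPreprimitive G (Fin n) := by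
  have := isPretransitive_of_index_dvd_numDerangements hG
  refine ⟨fun {B} hB ↦ ?_⟩
  by_contra hB'
  rw [MulAction.IsTrivialBlock, not_or, ← Set.ncard_le_one_iff_subsingleton, not_le,
    Set.eq_univ_iff_ncard, Nat.card_fin] at hB'
  obtain ⟨hB1, hBn⟩ := hB'
  have hBne : B.Nonempty := Set.nonempty_of_ncard_ne_zero (by omega)
  have hBdvd : B.ncard ∣ n := by simpa using hB.ncard_dvd_card hBne
  replace hBn : B.ncard < n := lt_of_le_of_ne (Nat.le_of_dvd (by omega) hBdvd) hBn
  obtain ⟨p, m, hp, hpn⟩ := exists_eq_prime_pow_of_isBlock hG hB hB1 hBn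
  -- An even `n` is a power of 2 above 4, so `(n - 2) / 2` is odd and provides an odd prime factor
  -- of `n - 2`.
  have h4 : 2 ∣ n → 4 ∣ n := by
    intro h
    obtain rfl := (Nat.prime_dvd_prime_iff_eq Nat.prime_two hp).mp
      (Nat.prime_two.dvd_of_dvd_pow (hpn ▸ h))
    have hm : 2 ≤ m := by
      by_contra! hm
      interval_cases m <;> omega
    rw [hpn]
    exact pow_dvd_pow 2 hm
  obtain ⟨q, hq, hqn, hq2⟩ : ∃ q, q.Prime ∧ q ∣ n - 2 ∧ q ≠ 2 := by
    rcases Nat.even_or_odd' n with ⟨c, hc | hc⟩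
    · have h1 := Nat.minFac_prime (n := c - 1) (by omega)
      have h2 := Nat.minFac_dvd (c - 1)
      refine ⟨_, h1, h2.trans ⟨2, by omega⟩, fun h ↦ ?_⟩
      rw [h] at h2
      have := h4 ⟨c, hc⟩
      omega
    · have h1 := Nat.minFac_prime (n := n - 2) (by omega)
      have h2 := Nat.minFac_dvd (n - 2)
      refine ⟨_, h1, h2, fun h ↦ ?_⟩
      rw [h] at h2
      omega
  have hqn' : ¬ q ∣ n := by
    intro h
    have := (Nat.dvd_sub_iff_right (by omega) h).mp hqn
    exact hq2 ((Nat.prime_dvd_prime_iff_eq hq Nat.prime_two).mp this)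
  have horb : B.ncard * (MulAction.orbit G B).ncard = n := by
    simpa using hB.ncard_block_mul_ncard_orbit_eq hBne
  have h2B : 2 * B.ncard = n := by
    obtain ⟨e, he⟩ := exists_equiv_column_subset hG hq (by omega) hqn
      (by simpa [numDerangements_add_two] using hq.one_lt.ne') hqn'
    -- A translate of `B` missing both leftover points would have size divisible by `q`, whence `q ∣
    -- n`. Hence there are at most two translates.
    have hmeet : ∀ C ∈ MulAction.orbit G B, ∃ y, e.symm (Sum.inr y) ∈ C := by
      rintro _ ⟨g, rfl⟩
      by_contra! hemp
      have hcard : (g • B).ncard = B.ncard := Set.ncard_smul_set _ _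
      obtain ⟨t, ht⟩ := he (g • B) (hB.translate g) (by rwa [hcard]) (by rwa [hcard])
      have h0 : {y | e.symm (Sum.inr y) ∈ g • B} = ∅ := by
        ext y
        simpa using hemp y
      rw [hcard, h0, Set.ncard_empty, add_zero] at ht
      exact hqn' (((Dvd.intro _ ht.symm)).trans hBdvd)
    choose! y hy using hmeet
    have hle : (MulAction.orbit G B).ncard ≤ 2 := by
      have : (MulAction.orbit G B).ncard ≤ (Set.univ : Set (Fin 2)).ncard := by
        refine Set.ncard_le_ncard_of_injOn y (fun _ _ ↦ Set.mem_univ _) ?_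
        rintro _ ⟨g₁, rfl⟩ _ ⟨g₂, rfl⟩ h
        refine (MulAction.isBlock_iff_smul_eq_smul_of_nonempty.mp hB)
          ⟨_, hy _ ⟨g₁, rfl⟩, ?_⟩
        rw [h]
        exact hy _ ⟨g₂, rfl⟩
      simpa using this
    interval_cases h : (MulAction.orbit G B).ncard <;> omega
  have hp2 : p = 2 := by
    have : 2 ∣ p ^ m := hpn ▸ ⟨_, h2B.symm⟩
    exact ((Nat.prime_dvd_prime_iff_eq Nat.prime_two hp).mp
      (Nat.prime_two.dvd_of_dvd_pow this)).symm
  subst hp2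
  have h3 : ¬ 3 ∣ n := by
    intro h
    rw [hpn] at h
    have := Nat.prime_three.dvd_of_dvd_pow h
    omega
  have h1 := Nat.minFac_prime (n := n - 3) (by omega)
  have h2 := Nat.minFac_dvd (n - 3)
  set q' := (n - 3).minFac
  have hq'2 : q' ≠ 2 := fun h ↦ by rw [h] at h2; omega
  have hq'3 : q' ≠ 3 := fun h ↦ by rw [h] at h2; omega
  have hq'n : ¬ q' ∣ n := by
    intro h
    have := (Nat.dvd_sub_iff_right (by omega) h).mp h2
    exact hq'3 ((Nat.prime_dvd_prime_iff_eq h1 Nat.prime_three).mp this)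
  obtain ⟨e, he⟩ := exists_equiv_column_subset hG h1 (by omega) h2
    (fun h ↦ hq'2 ((Nat.prime_dvd_prime_iff_eq h1 Nat.prime_two).mp h)) hq'n
  obtain ⟨t, ht⟩ := he B hB hB1 hBdvd
  have hf : {y | e.symm (Sum.inr y) ∈ B}.ncard ≤ 3 := by
    simpa using Set.ncard_le_card {y | e.symm (Sum.inr y) ∈ B}
  obtain ⟨c, hc⟩ := h2
  have hq'5 : 5 ≤ q' := by
    have := h1.two_le
    have : q' ≠ 4 := by intro h; rw [h] at h1; norm_num at h1
    omega
  -- The right side is odd, hence nonzero, and at most 3 in absolute value, so `q' ≥ 5` cannot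
  -- divide it.
  have hz : (q' : ℤ) * (2 * t - c) = 3 - 2 * {y | e.symm (Sum.inr y) ∈ B}.ncard := by
    zify [show 3 ≤ n by omega] at hc ht h2B
    linear_combination hc - 2 * ht + h2B
  have hz' : (q' : ℤ) ∣ 3 - 2 * {y | e.symm (Sum.inr y) ∈ B}.ncard := Dvd.intro _ hz
  have := Nat.le_of_dvd (by omega) (Int.natCast_dvd.mp hz')
  omega

end Block

/-! ### Cycles of prime length and Jordan's theorem -/

section Cycle

variable {α : Type*} [Fintype α] [DecidableEq α] {G : Subgroup (Perm α)}

/-- If `d` fixes every point moved by `c` except `x`, which it sends to a fixed point of `c`,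
then the commutator of `c` and `d` is a three-cycle. -/
theorem isThreeCycle_commutator {c d : Perm α} {x : α} (hx : c x ≠ x)
    (hd : ∀ z, c z ≠ z → z ≠ x → d z = z) (hdx : c (d x) = d x) :
    (c * (d * c⁻¹ * d⁻¹)).IsThreeCycle := by
  have hne : d x ≠ x := fun h ↦ hx (by rwa [h] at hdx)
  have hne' : d x ≠ c x := fun h ↦ hx (c.injective (by rw [← h, hdx]))
  -- This product fixes the support of `c` pointwise, so conjugating `c⁻¹` by `d` amounts to
  -- conjugating it by a transposition. The commutator becomes a product of two transpositions
  -- sharing `d x`.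
  have hcomm : Commute c (swap x (d x) * d) := by
    refine Perm.Disjoint.commute fun z ↦ or_iff_not_imp_left.mpr fun hz ↦ ?_
    rcases eq_or_ne z x with rfl | hzx
    · simp
    · rw [Perm.mul_apply, hd z hz hzx, swap_apply_of_ne_of_ne hzx]
      rintro rfl
      exact hz hdx
  have h1 : d * c⁻¹ * d⁻¹ = swap x (d x) * c⁻¹ * swap x (d x) := by
    have hs : (swap x (d x))⁻¹ = swap x (d x) := swap_inv x (d x)
    generalize swap x (d x) = s at hcomm hs
    have h2 := hcomm.inv_left.eq
    calc d * c⁻¹ * d⁻¹ = s⁻¹ * (s * d * c⁻¹) * d⁻¹ := by group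
      _ = s * c⁻¹ * s := by rw [← h2, hs]; group
  have h2 : c * (d * c⁻¹ * d⁻¹) = swap (d x) (c x) * swap (d x) x := by
    have h3 := swap_apply_apply c x (d x)
    rw [hdx, swap_comm] at h3
    rw [h1, h3, swap_comm (d x) x]
    simp only [mul_assoc]
  rw [h2]
  exact Perm.isThreeCycle_swap_mul_swap_same hne' hne hx

theorem exists_isCycle_mem_of_not_dvd_index {p : ℕ} (hp : p.Prime) (hG : ¬ p ∣ G.index)
    (hpα : p ≤ Nat.card α) : ∃ c ∈ G, c.IsCycle ∧ c.support.card = p := by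
  have : Fact p.Prime := ⟨hp⟩
  obtain ⟨c, hc⟩ := (Perm.exists_with_cycleType_iff (α := α) (m := {p})).mpr
    ⟨by simpa using hpα, by simpa using hp.two_le⟩
  have hord : orderOf c = p := by rw [← Perm.lcm_cycleType, hc]; simp
  have hP : IsPGroup p (Subgroup.zpowers c) := by
    refine IsPGroup.of_card (n := 1) ?_
    rw [Nat.card_zpowers, hord, pow_one]
  obtain ⟨g, hg⟩ := exists_conj_smul_le_of_not_dvd_index hG hP
  have hct : (g * c * g⁻¹).cycleType = {p} := by rw [Perm.cycleType_conj, hc]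
  refine ⟨g * c * g⁻¹, hg (Subgroup.smul_mem_pointwise_smul c (MulAut.conj g) _
    (Subgroup.mem_zpowers c)), ?_, ?_⟩
  · rw [← Perm.card_cycleType_eq_one, hct, Multiset.card_singleton]
  · rw [← Perm.sum_cycleType, hct, Multiset.sum_singleton]

/-- A primitive group of degree `n` containing a cycle of prime length `p ≤ n - 1` is
`n - p + 1` times transitive (Jordan). -/
theorem isMultiplyPretransitive_of_isCycle_mem (hG : MulAction.IsPreprimitive G α) {p k : ℕ}
    (hp : p.Prime) (hk : p + k + 1 = Nat.card α) {c : Perm α} (hcG : c ∈ G) (hc : c.IsCycle)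
    (hcp : c.support.card = p) : MulAction.IsMultiplyPretransitive G α (k + 2) := by
  classical
  suffices h : MulAction.IsMultiplyPreprimitive G α (k + 2) from h.isMultiplyPretransitive
  apply hG.isMultiplyPreprimitive (s := (c.supportᶜ : Set α))
  · apply Nat.add_left_cancel
    rw [Set.ncard_add_ncard_compl, Set.ncard_coe_finset, hcp, ← hk, add_assoc]
  · have := hp.two_le
    omega
  have := Perm.isPretransitive_of_isCycle_mem hc hcG
  apply MulAction.IsPreprimitive.of_prime_card
  convert! hp
  rw [Nat.card_eq_fintype_card, Fintype.card_subtype, ← hcp]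
  apply congr_arg
  ext x
  simp [SubMulAction.mem_ofFixingSubgroup_iff]

/-- As `p ≤ n - p + 1`, `G` is `p`-transitive, so some `d` in `G` moves just one point of the
support of `c` and sends it outside. -/
theorem alternatingGroup_le_of_isCycle_mem_of_two_mul_le (hG : MulAction.IsPreprimitive G α)
    {p : ℕ} (hp : p.Prime) (hpα : 2 * p ≤ Nat.card α) {c : Perm α} (hcG : c ∈ G)
    (hc : c.IsCycle) (hcp : c.support.card = p) : alternatingGroup α ≤ G := by
  have hp2 := hp.two_le
  have htrans : MulAction.IsMultiplyPretransitive G α p := by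
    have h := isMultiplyPretransitive_of_isCycle_mem hG (k := Nat.card α - p - 1) hp (by omega)
      hcG hc hcp
    refine MulAction.isMultiplyPretransitive_of_le (n := Nat.card α - p - 1 + 2) ?_ ?_ <;> omega
  obtain ⟨x, hx, -⟩ := hc
  obtain ⟨w, hw⟩ : ∃ w, w ∉ c.support := by
    by_contra! h
    have : c.support = Finset.univ := Finset.eq_univ_of_forall h
    rw [this, Finset.card_univ, ← Nat.card_eq_fintype_card] at hcp
    omega
  let f : Fin p ↪ α := (Finset.equivFinOfCardEq hcp).symm.toEmbedding.trans
    (Function.Embedding.subtype _)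
  obtain ⟨d, hd⟩ := MulAction.exists_smul_eq G f (f.trans (swap x w).toEmbedding)
  have hd' : ∀ z ∈ c.support, (d : Perm α) z = swap x w z := by
    intro z hz
    have := DFunLike.congr_fun hd (Finset.equivFinOfCardEq hcp ⟨z, hz⟩)
    simpa [f, Subgroup.smul_def] using this
  have hxs : x ∈ c.support := Perm.mem_support.mpr hx
  have hdx : (d : Perm α) x = w := by rw [hd' x hxs, swap_apply_left]
  refine Perm.alternatingGroup_le_of_isPreprimitive_of_isThreeCycle_mem hG
    (isThreeCycle_commutator (d := d) hx (fun z hz hzx ↦ ?_) ?_)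
    (G.mul_mem hcG (G.mul_mem (G.mul_mem d.2 (G.inv_mem hcG)) (G.inv_mem d.2)))
  · have hz' : z ∈ c.support := Perm.mem_support.mpr hz
    rw [hd' z hz', swap_apply_of_ne_of_ne hzx]
    rintro rfl
    exact hw hz'
  · rw [hdx]
    exact Perm.notMem_support.mp hw

/-- A subgroup whose index is so small that the action on its cosets cannot be faithful contains
the alternating group. -/
theorem alternatingGroup_le_of_factorial_index_lt (hα : 5 ≤ Nat.card α)
    (h : G.index.factorial < (Nat.card α).factorial) : alternatingGroup α ≤ G := by
  have hcore : Nontrivial G.normalCore := by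
    rw [Subgroup.nontrivial_iff_ne_bot]
    intro hbot
    rw [Subgroup.normalCore_eq_ker, MonoidHom.ker_eq_bot_iff] at hbot
    have hle := Nat.card_le_card_of_injective _ hbot
    rw [Nat.card_perm, Nat.card_perm, ← Subgroup.index_eq_card] at hle
    omega
  exact (Perm.alternatingGroup_le_of_normal hα hcore).trans G.normalCore_le

theorem eq_alternatingGroup_or_eq_top_of_le (h : alternatingGroup α ≤ G) :
    G = alternatingGroup α ∨ G = ⊤ := by
  rcases subsingleton_or_nontrivial α with _ | _
  · exact Or.inr (Subsingleton.elim _ _)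
  have hdvd := Subgroup.index_dvd_of_le h
  rw [alternatingGroup.index_eq_two] at hdvd
  rcases (Nat.dvd_prime Nat.prime_two).mp hdvd with h1 | h2
  · exact Or.inr (Subgroup.index_eq_one.mp h1)
  · exact Or.inl (Perm.eq_alternatingGroup_of_index_eq_two h2)

end Cycle

theorem alternatingGroup_le_of_index_dvd_numDerangements {n : ℕ} (hn : 5 ≤ n)
    {G : Subgroup (Perm (Fin n))} (hG : G.index ∣ numDerangements n) :
    alternatingGroup (Fin n) ≤ G := by
  have hprim := isPreprimitive_of_index_dvd_numDerangements hn hG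
  rcases eq_or_ne n 5 with rfl | h5
  · obtain ⟨c, hcG, hc, hc3⟩ := exists_isCycle_mem_of_not_dvd_index (G := G) Nat.prime_three
      (fun h ↦ absurd (h.trans hG) (by decide)) (by simp)
    exact Perm.alternatingGroup_le_of_isPreprimitive_of_isThreeCycle_mem hprim
      (card_support_eq_three_iff.mp hc3) hcG
  rcases eq_or_ne n 7 with rfl | h7
  · obtain ⟨c, hcG, hc, hc5⟩ := exists_isCycle_mem_of_not_dvd_index (G := G) Nat.prime_five
      (fun h ↦ absurd (h.trans hG) (by decide)) (by simp)
    have htrans := isMultiplyPretransitive_of_isCycle_mem hprim (k := 1) Nat.prime_five (by simp)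
      hcG hc hc5
    have h3 : ({0, 1, 2} : Set (Fin 7)).ncard = 3 := by
      rw [Set.ncard_eq_toFinset_card']
      rfl
    -- 3-transitivity gives `7 * 6 * 5 = 210 ∣ |G|`, so the index divides `7! / 210 = 24`, and also
    -- `gcd(D_7, 24) = 6`.
    have hidx := htrans.index_of_fixingSubgroup_mul h3
    have hmul := G.index_mul_card
    rw [← (fixingSubgroup G ({0, 1, 2} : Set (Fin 7))).index_mul_card, Nat.card_perm] at hmul
    have h24 : G.index ∣ 24 := by
      refine ⟨Nat.card (fixingSubgroup G ({0, 1, 2} : Set (Fin 7))), ?_⟩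
      simp [Nat.factorial] at hidx hmul
      rw [show (fixingSubgroup G ({0, 1, 2} : Set (Fin 7))).index = 210 by omega] at hmul
      linarith
    have h6 : G.index ∣ 6 := (Nat.dvd_gcd hG h24).trans (by decide)
    refine alternatingGroup_le_of_factorial_index_lt (by simp) ?_
    refine (Nat.factorial_le (Nat.le_of_dvd (by norm_num) h6)).trans_lt ?_
    rw [Nat.card_fin]
    decide
  obtain ⟨p, hp, hpn, hpD⟩ := exists_prime_two_mul_le_not_dvd_numDerangements hn h5 h7
  obtain ⟨c, hcG, hc, hcp⟩ := exists_isCycle_mem_of_not_dvd_index (G := G) hp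
    (fun h ↦ hpD (h.trans hG)) (by simp; omega)
  exact alternatingGroup_le_of_isCycle_mem_of_two_mul_le hprim hp (by simpa using hpn) hcG hc hcp

/-! ### Signs of derangements -/

section Sign

open Matrix in
/-- The even derangements do not balance the odd ones: the difference of their numbers is the
determinant of the matrix with zero diagonal and all other entries equal to one. -/
theorem sum_sign_derangements {n : ℕ} :
    ∑ σ : Perm (Fin n) with ∀ x, σ x ≠ x, (Perm.sign σ : ℤ) = (-1) ^ n * (1 - n) := by
  let M : Matrix (Fin n) (Fin n) ℤ := Matrix.of fun i j ↦ if i = j then 0 else 1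
  have hM : M = -(1 + replicateCol Unit (fun _ : Fin n ↦ (-1 : ℤ)) *
      replicateRow Unit fun _ : Fin n ↦ (1 : ℤ)) := by
    ext i j
    simp [M, Matrix.mul_apply, Matrix.one_apply]
    split_ifs <;> simp
  have hdet : M.det = (-1) ^ n * (1 - n) := by
    rw [hM, Matrix.det_neg, Matrix.det_one_add_replicateCol_mul_replicateRow]
    simp [dotProduct, sub_eq_add_neg]
  rw [← hdet, Matrix.det_apply, Finset.sum_filter]
  refine Finset.sum_congr rfl fun σ _ ↦ ?_
  split_ifs with h
  · rw [Finset.prod_eq_one fun i _ ↦ by simp [M, h i]]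
    simp [Units.smul_def]
  · push Not at h
    obtain ⟨x, hx⟩ := h
    rw [Finset.prod_eq_zero (Finset.mem_univ x) (by simp [M, hx]), smul_zero]

theorem ncard_even_derangements_ne {n : ℕ} (hn : 2 ≤ n) :
    {σ : Perm (Fin n) | Perm.sign σ = 1 ∧ ∀ x, σ x ≠ x}.ncard ≠
      {σ : Perm (Fin n) | Perm.sign σ = -1 ∧ ∀ x, σ x ≠ x}.ncard := by
  intro h
  have hsum := sum_sign_derangements (n := n)
  rw [Finset.sum_congr rfl (g := fun σ ↦ (if Perm.sign σ = 1 then 1 else 0) -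
    (if Perm.sign σ = -1 then 1 else (0 : ℤ))) fun σ _ ↦ by
      rcases Int.units_eq_one_or (Perm.sign σ) with h | h <;> rw [h] <;> simp +decide,
    Finset.sum_sub_distrib, Finset.sum_boole, Finset.sum_boole, Finset.filter_filter,
    Finset.filter_filter] at hsum
  simp only [Set.ncard_eq_toFinset_card', Set.toFinset_ofPred, and_comm] at h hsum
  rw [h, sub_self, eq_comm, mul_eq_zero] at hsum
  rcases hsum with h | h
  · simp at h
  · omega

end Sign

/-! ### Cosets of the alternating group -/

section Coset

theorem IsCosetOf.ncard_eq {Γ : Type*} [Group Γ] {C : Set Γ} {G : Subgroup Γ}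
    (h : IsCosetOf C G) : C.ncard = Nat.card G := by
  rcases h with ⟨g, rfl⟩ | ⟨g, rfl⟩ <;> rw [Set.ncard_smul_set] <;> rfl

theorem IsCosetOf.eq_univ {Γ : Type*} [Group Γ] {C : Set Γ} (h : IsCosetOf C (⊤ : Subgroup Γ)) :
    C = Set.univ := by
  rcases h with ⟨g, rfl⟩ | ⟨g, rfl⟩ <;> simp

variable {n : ℕ} {C : Set (Perm (Fin n))}

theorem IsCosetOf.eq_setOf_sign_eq (h : IsCosetOf C (alternatingGroup (Fin n))) :
    ∃ ε : ℤˣ, C = {σ | Perm.sign σ = ε} := by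
  rcases h with ⟨g, rfl⟩ | ⟨g, rfl⟩
  · refine ⟨Perm.sign g, ?_⟩
    ext σ
    rw [Set.mem_smul_set_iff_inv_smul_mem, SetLike.mem_coe, Perm.mem_alternatingGroup,
      smul_eq_mul, map_mul, map_inv, inv_mul_eq_one, eq_comm, Set.mem_ofPred_eq]
  · refine ⟨Perm.sign g, ?_⟩
    ext σ
    rw [Set.mem_smul_set_iff_inv_smul_mem, SetLike.mem_coe, Perm.mem_alternatingGroup,
      ← MulOpposite.op_inv, op_smul_eq_mul, map_mul, map_inv, mul_inv_eq_one, Set.mem_ofPred_eq]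

/-- A subset with the same proportion of derangements as the symmetric group, and `m` times
smaller, has `m` times fewer derangements. -/
theorem mul_ncard_derangements {m : ℕ} (hm : C.ncard * m = n.factorial)
    (h : derangementProportion C = derangementProportion (Set.univ : Set (Perm (Fin n)))) :
    {σ | σ ∈ C ∧ ∀ x, σ x ≠ x}.ncard * m = numDerangements n := by
  rw [derangementProportion_univ, derangementProportion, ← hm] at h
  have hn : ((C.ncard * m : ℕ) : ℚ) ≠ 0 := by
    rw [hm]
    exact_mod_cast n.factorial_ne_zero
  push_cast at h hn
  rw [mul_ne_zero_iff] at hn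
  obtain ⟨h1, h2⟩ := hn
  field_simp at h
  exact_mod_cast h

theorem derangementProportion_ne_of_isCosetOf_alternatingGroup (hn : 2 ≤ n)
    (hC : IsCosetOf C (alternatingGroup (Fin n))) :
    derangementProportion C ≠ derangementProportion (Set.univ : Set (Perm (Fin n))) := by
  intro h
  have : Nontrivial (Fin n) := Fin.nontrivial_iff_two_le.mpr hn
  have h2 := mul_ncard_derangements (m := 2) (by
    have := (alternatingGroup (Fin n)).card_mul_index
    rw [alternatingGroup.index_eq_two, Nat.card_perm, Nat.card_fin] at this
    rw [hC.ncard_eq, this]) h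
  have hsplit : {σ : Perm (Fin n) | ∀ x, σ x ≠ x} =
      {σ | Perm.sign σ = 1 ∧ ∀ x, σ x ≠ x} ∪ {σ | Perm.sign σ = -1 ∧ ∀ x, σ x ≠ x} := by
    ext σ
    rcases Int.units_eq_one_or (Perm.sign σ) with h | h <;> simp [h]
  have hcard := ncard_derangements n
  rw [hsplit, Set.ncard_union_eq] at hcard
  · obtain ⟨ε, rfl⟩ := hC.eq_setOf_sign_eq
    have hne := ncard_even_derangements_ne hn
    simp only [Set.mem_ofPred_eq] at h2
    rcases Int.units_eq_one_or ε with rfl | rfl <;> omega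
  · rw [Set.disjoint_left]
    rintro σ ⟨h1, -⟩ ⟨h2, -⟩
    rw [h1] at h2
    exact absurd h2 (by decide)

end Coset

/-! ### Degree four and conclusion -/

/-- The permutations of `Fin 4` that preserve the antipodal relation of a square. -/
def squareSymmetries : Subgroup (Perm (Fin 4)) := Subgroup.centralizer {Equiv.addRight 2}

theorem mem_squareSymmetries {σ : Perm (Fin 4)} :
    σ ∈ squareSymmetries ↔ ∀ x, σ (x + 2) = σ x + 2 := by
  rw [squareSymmetries, Subgroup.mem_centralizer_singleton_iff, Equiv.ext_iff]
  rfl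

theorem card_squareSymmetries : Nat.card squareSymmetries = 8 := by
  rw [Nat.card_congr (Equiv.subtypeEquivRight fun σ ↦ mem_squareSymmetries (σ := σ)),
    Nat.card_eq_fintype_card, Fintype.card_subtype]
  decide +kernel

theorem card_derangements_coset_squareSymmetries (k : Perm (Fin 4)) :
    Finset.card {σ : Perm (Fin 4) | (∀ x, (k * σ) (x + 2) = (k * σ) x + 2) ∧ ∀ x, σ x ≠ x} ≠ 3 ∧
    Finset.card {σ : Perm (Fin 4) | (∀ x, (σ * k) (x + 2) = (σ * k) x + 2) ∧ ∀ x, σ x ≠ x} ≠ 3 := by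
  revert k
  decide +kernel

theorem ncard_conj_derangements {α : Type*} (g : Perm α) (C : Set (Perm α)) :
    {σ | g * σ * g⁻¹ ∈ C ∧ ∀ x, σ x ≠ x}.ncard = {σ | σ ∈ C ∧ ∀ x, σ x ≠ x}.ncard := by
  rw [← Set.ncard_image_of_injective _ (MulAut.conj g).injective]
  congr 1
  ext σ
  constructor
  · rintro ⟨τ, ⟨h1, h2⟩, rfl⟩
    refine ⟨h1, fun x hx ↦ h2 (g⁻¹ x) ?_⟩
    rw [MulAut.conj_apply, Perm.mul_apply, Perm.mul_apply] at hx
    exact Perm.eq_inv_iff_eq.mpr hx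
  · rintro ⟨h1, h2⟩
    refine ⟨g⁻¹ * σ * g, ⟨by simpa [mul_assoc] using h1, fun x hx ↦ h2 (g x) ?_⟩, by
      simp [mul_assoc]⟩
    rw [Perm.mul_apply, Perm.mul_apply, Perm.inv_eq_iff_eq] at hx
    exact hx

/-- Such a `G` is a Sylow 2-subgroup, hence conjugate to `squareSymmetries`. The proportion `9 / 24`
would require 3 derangements among the 8 elements of a coset. -/
theorem ncard_derangements_ne_three_of_index_eq_three {G : Subgroup (Perm (Fin 4))}
    (hG : G.index = 3) {C : Set (Perm (Fin 4))} (hC : IsCosetOf C G) :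
    {σ | σ ∈ C ∧ ∀ x, σ x ≠ x}.ncard ≠ 3 := by
  classical
  have : Fact (Nat.Prime 2) := ⟨Nat.prime_two⟩
  obtain ⟨g, hg⟩ := exists_conj_smul_le_of_not_dvd_index (p := 2) (G := G)
    (P := squareSymmetries) (by rw [hG]; norm_num)
    (IsPGroup.of_card (n := 3) (by rw [card_squareSymmetries]; norm_num))
  have hGcard : Nat.card G = 8 := by
    have := G.index_mul_card
    rw [hG, Nat.card_perm, Nat.card_fin, show Nat.factorial 4 = 24 from rfl] at this
    omega
  have hGeq : MulAut.conj g • squareSymmetries = G := by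
    refine Subgroup.eq_of_le_of_card_ge hg ?_
    rw [hGcard, ← card_squareSymmetries]
    exact (Nat.card_congr (Subgroup.equivSMul (MulAut.conj g) squareSymmetries).toEquiv).le
  have hmem : ∀ σ, σ ∈ G ↔ g⁻¹ * σ * g ∈ squareSymmetries := by
    intro σ
    rw [← hGeq, Subgroup.mem_pointwise_smul_iff_inv_smul_mem, ← map_inv, MulAut.smul_def,
      MulAut.conj_apply, inv_inv]
  rw [← ncard_conj_derangements g]
  rcases hC with ⟨h, rfl⟩ | ⟨h, rfl⟩
  · convert (card_derangements_coset_squareSymmetries (g⁻¹ * h⁻¹ * g)).1 using 1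
    rw [Set.ncard_eq_toFinset_card']
    congr 1
    ext σ
    simp only [Set.mem_toFinset, Set.mem_ofPred_eq, Finset.mem_filter, Finset.mem_univ, true_and,
      Set.mem_smul_set_iff_inv_smul_mem, SetLike.mem_coe, hmem, smul_eq_mul,
      ← mem_squareSymmetries]
    simp [mul_assoc]
  · convert (card_derangements_coset_squareSymmetries (g⁻¹ * h⁻¹ * g)).2 using 1
    rw [Set.ncard_eq_toFinset_card']
    congr 1
    ext σ
    simp only [Set.mem_toFinset, Set.mem_ofPred_eq, Finset.mem_filter, Finset.mem_univ, true_and,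
      Set.mem_smul_set_iff_inv_smul_mem, SetLike.mem_coe, hmem, ← MulOpposite.op_inv,
      op_smul_eq_mul, ← mem_squareSymmetries]
    simp [mul_assoc]

theorem eq_top_of_isCosetOf {n : ℕ} (hn : 1 ≤ n) {G : Subgroup (Perm (Fin n))}
    {C : Set (Perm (Fin n))} (hC : IsCosetOf C G)
    (h : derangementProportion C = derangementProportion (Set.univ : Set (Perm (Fin n)))) :
    G = ⊤ := by
  have hG : G.index ∣ numDerangements n :=
    index_dvd_numDerangements (hC.ncard_eq ▸ den_dvd_ncard h)
  rcases hn.eq_or_lt with rfl | hn2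
  · exact Subsingleton.elim _ _
  have : Nontrivial (Fin n) := Fin.nontrivial_iff_two_le.mpr hn2
  have hidx : G.index ≠ 2 := by
    intro h2
    obtain rfl := Perm.eq_alternatingGroup_of_index_eq_two h2
    exact derangementProportion_ne_of_isCosetOf_alternatingGroup hn2 hC h
  rw [← Subgroup.index_eq_one]
  have hmul := G.index_mul_card
  rw [Nat.card_perm, Nat.card_fin] at hmul
  rcases lt_or_ge n 5 with hn5 | hn5
  · interval_cases n
    · exact Nat.dvd_one.mp hG
    · exact ((Nat.dvd_prime Nat.prime_two).mp hG).resolve_right hidx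
    · have h3 : G.index ∣ 3 :=
        (Nat.dvd_gcd hG (Dvd.intro _ hmul)).trans (by decide)
      refine ((Nat.dvd_prime Nat.prime_three).mp h3).resolve_right fun h3 ↦ ?_
      refine ncard_derangements_ne_three_of_index_eq_three h3 hC ?_
      have := mul_ncard_derangements (m := 3) (by rw [hC.ncard_eq, ← hmul, h3, mul_comm]) h
      rw [show numDerangements 4 = 9 from rfl] at this
      omega
  · rcases eq_alternatingGroup_or_eq_top_of_le
      (alternatingGroup_le_of_index_dvd_numDerangements hn5 hG) with rfl | rfl
    · exact absurd alternatingGroup.index_eq_two hidx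
    · exact Subgroup.index_top

theorem theorem1p1 (n : ℕ) (hn : 1 ≤ n) :
    -- a coset with the same proportion of derangements as the symmetric group
    (∀ (G : Subgroup (Perm (Fin n))) (C : Set (Perm (Fin n))), IsCosetOf C G →
      derangementProportion C = derangementProportion (Set.univ : Set (Perm (Fin n))) →
        G = ⊤ ∧ C = Set.univ) ∧
    -- an arbitrary subset of the same size as the subgroup
    (5 ≤ n → ∀ (G : Subgroup (Perm (Fin n))) (C : Set (Perm (Fin n))), C.ncard = Nat.card G →
      derangementProportion C = derangementProportion (Set.univ : Set (Perm (Fin n))) →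
        G = alternatingGroup (Fin n) ∨ G = ⊤) ∧
    -- the order of the subgroup is divisible by the denominator of the proportion
    (5 ≤ n → ∀ G : Subgroup (Perm (Fin n)),
      (derangementProportion (Set.univ : Set (Perm (Fin n)))).den ∣ Nat.card G →
        G = alternatingGroup (Fin n) ∨ G = ⊤) := by
  have main : 5 ≤ n → ∀ G : Subgroup (Perm (Fin n)),
      (derangementProportion (Set.univ : Set (Perm (Fin n)))).den ∣ Nat.card G →
        G = alternatingGroup (Fin n) ∨ G = ⊤ := fun hn5 G hG ↦
    eq_alternatingGroup_or_eq_top_of_le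
      (alternatingGroup_le_of_index_dvd_numDerangements hn5 (index_dvd_numDerangements hG))
  refine ⟨fun G C hC h ↦ ?_, fun hn5 G C hC h ↦ main hn5 G (hC ▸ den_dvd_ncard h), main⟩
  obtain rfl := eq_top_of_isCosetOf hn hC h
  exact ⟨rfl, hC.eq_univ⟩
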